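/- Let $1\le k\le n$ and $A\in\mathcal M_n(\mathbb C)$. For $m\ge 1$ let $\mathcal X_m$ be the set of $n\times m$ complex matrices $X$ with $X^*X=I_m$, and $\mathcal Y_m=\{XX^*: X\in\mathcal X_m\}$. Let $$\Lambda_k(A)=\{\lambda\in\mathbb C:\ X^*AX=\lambda I_k\ \text{for some}\ X\in\mathcal X_k\},\qquad r_k(A)=\max\{|z|:z\in\partial\Lambda_k(A)\},\quad \widetilde r_k(A)=\min\{|z|:z\in\partial\Lambda_k(A)\},$$ and assume $\Lambda_k(A)\neq\emptyset$. For a square complex matrix $B$ let $F(B)=\{x^*Bx: x^*x=1\}$, $r(B)=\max\{|z|:z\in\partial F(B)\}$ and $\widetilde r(B)=\min\{|z|:z\in\partial F(B)\}$. Let $M_p\in\mathcal X_{n-k+1}$, $p\in\mathbb N$. Then $$r_k(A)\le\inf_{p\in\mathbb N} r(M_p^*AM_p).$$ Suppose moreover that $0\notin\Lambda_k(A)$, and that the family $(M_p)$ satisfies $\Lambda_k(A)=\bigcap_{p\in\mathbb N}F(M_p^*AM_p)$, or that the projections $M_pM_p^*$, $p\in\mathbb N$, are dense in $\mathcal Y_{n-k+1}$.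 Then $$\widetilde r_k(A)\ge\inf_{p\in\mathbb N}\widetilde r(M_p^*AM_p).$$ -/

import Mathlib

open Matrix

noncomputable section

namespace KRank

/-- `𝒳_m`: the `n × m` complex matrices `X` with `X* X = I_m` (isometries). -/
def isometries (n m : ℕ) : Set (Matrix (Fin n) (Fin m) ℂ) :=
  {X | Xᴴ * X = 1}

/-- `𝒴_m`: the orthogonal projections `X X*` of `ℂⁿ` of rank `m`, with `X ∈ 𝒳_m`. -/
def projections (n m : ℕ) : Set (Matrix (Fin n) (Fin n) ℂ) :=
  {P | ∃ X ∈ isometries n m, P = X * Xᴴ}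

/-- The `k`-rank numerical range `Λ_k(A)`. -/
def rankRange {n : ℕ} (k : ℕ) (A : Matrix (Fin n) (Fin n) ℂ) : Set ℂ :=
  {z | ∃ X ∈ isometries n k, Xᴴ * A * X = z • (1 : Matrix (Fin k) (Fin k) ℂ)}

/-- The classical numerical range `F(A) = {x* A x : x* x = 1}`. -/
def numRange {n : ℕ} (A : Matrix (Fin n) (Fin n) ℂ) : Set ℂ :=
  {z | ∃ x : Fin n → ℂ, star x ⬝ᵥ x = 1 ∧ star x ⬝ᵥ (A *ᵥ x) = z}

/-- The largest modulus of a boundary point of `K`. -/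
def outerRadius (K : Set ℂ) : ℝ := sSup ((fun z : ℂ => ‖z‖) '' frontier K)

/-- The least modulus of a boundary point of `K`. -/
def innerRadius (K : Set ℂ) : ℝ := sInf ((fun z : ℂ => ‖z‖) '' frontier K)

/-- The `k`-rank numerical radius `r_k(A)`. -/
def rankRadius {n : ℕ} (k : ℕ) (A : Matrix (Fin n) (Fin n) ℂ) : ℝ :=
  outerRadius (rankRange k A)

/-- The inner `k`-rank numerical radius. -/
def innerRankRadius {n : ℕ} (k : ℕ) (A : Matrix (Fin n) (Fin n) ℂ) : ℝ :=
  innerRadius (rankRange k A)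

/-- The numerical radius `r(A)`. -/
def numRadius {n : ℕ} (A : Matrix (Fin n) (Fin n) ℂ) : ℝ :=
  outerRadius (numRange A)

/-- The inner numerical radius. -/
def innerNumRadius {n : ℕ} (A : Matrix (Fin n) (Fin n) ℂ) : ℝ :=
  innerRadius (numRange A)

/-! The radii are genuine maxima and minima: the sets they are taken over are the boundaries of
nonempty compact sets. -/

theorem frontier_nonempty_of_compact {K : Set ℂ} (hK : IsCompact K) (hne : K.Nonempty) :
    (frontier K).Nonempty :=
  nonempty_frontier_iff.mpr ⟨hne, hK.ne_univ⟩

theorem isCompact_norm_image_frontier {K : Set ℂ} (hK : IsCompact K) :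
    IsCompact ((fun z : ℂ => ‖z‖) '' frontier K) :=
  (hK.of_isClosed_subset isClosed_frontier hK.isClosed.frontier_subset).image continuous_norm

theorem isGreatest_outerRadius {K : Set ℂ} (hK : IsCompact K) (hne : K.Nonempty) :
    IsGreatest ((fun z : ℂ => ‖z‖) '' frontier K) (outerRadius K) :=
  (isCompact_norm_image_frontier hK).isGreatest_sSup
    ((frontier_nonempty_of_compact hK hne).image _)

theorem isLeast_innerRadius {K : Set ℂ} (hK : IsCompact K) (hne : K.Nonempty) :
    IsLeast ((fun z : ℂ => ‖z‖) '' frontier K) (innerRadius K) :=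
  (isCompact_norm_image_frontier hK).isLeast_sInf
    ((frontier_nonempty_of_compact hK hne).image _)

theorem norm_le_one_of_star_dotProduct {n : ℕ} {x : Fin n → ℂ} (hx : star x ⬝ᵥ x = 1)
    (i : Fin n) : ‖x i‖ ≤ 1 := by
  have h : ∑ j, ‖x j‖ ^ 2 = (1 : ℝ) := by
    have h1 : ((∑ j, ‖x j‖ ^ 2 : ℝ) : ℂ) = 1 := by
      rw [← hx]
      push_cast
      simp only [dotProduct, Pi.star_apply]
      refine Finset.sum_congr rfl fun j _ => ?_
      simpa using (Complex.conj_mul' (x j)).symm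
    exact_mod_cast h1
  have h2 : ‖x i‖ ^ 2 ≤ ∑ j, ‖x j‖ ^ 2 :=
    Finset.single_le_sum (f := fun j => ‖x j‖ ^ 2) (fun j _ => sq_nonneg _) (Finset.mem_univ i)
  nlinarith [norm_nonneg (x i)]

theorem isCompact_isometries (n m : ℕ) : IsCompact (isometries n m) := by
  have hc : IsClosed (isometries n m) := by
    unfold isometries
    exact isClosed_eq (by fun_prop) continuous_const
  have hb : IsCompact (Set.univ.pi fun _ : Fin n => Set.univ.pi fun _ : Fin m =>
      Metric.closedBall (0 : ℂ) 1) :=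
    isCompact_univ_pi fun _ => isCompact_univ_pi fun _ => isCompact_closedBall _ _
  refine IsCompact.of_isClosed_subset hb hc fun X hX => ?_
  intro i _ j _
  rw [mem_closedBall_zero_iff]
  refine norm_le_one_of_star_dotProduct (x := fun i => X i j) ?_ i
  have := congrFun (congrFun hX j) j
  simpa [Matrix.mul_apply, dotProduct] using this

theorem isCompact_numRange {n : ℕ} (A : Matrix (Fin n) (Fin n) ℂ) : IsCompact (numRange A) := by
  have hs : IsCompact {x : Fin n → ℂ | star x ⬝ᵥ x = 1} := by
    have hb : IsCompact (Set.univ.pi fun _ : Fin n => Metric.closedBall (0 : ℂ) 1) :=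
      isCompact_univ_pi fun _ => isCompact_closedBall _ _
    refine IsCompact.of_isClosed_subset hb (isClosed_eq (by fun_prop) continuous_const)
      fun x hx i _ => ?_
    rw [mem_closedBall_zero_iff]
    exact norm_le_one_of_star_dotProduct hx i
  exact hs.image (f := fun x => star x ⬝ᵥ (A *ᵥ x)) (by fun_prop)

theorem isCompact_rankRange {n k : ℕ} (hk : 1 ≤ k) (A : Matrix (Fin n) (Fin n) ℂ) :
    IsCompact (rankRange k A) := by
  let g : Matrix (Fin n) (Fin k) ℂ → ℂ := fun X => (Xᴴ * A * X) ⟨0, hk⟩ ⟨0, hk⟩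
  have hg : Continuous g := by
    have : Continuous fun X : Matrix (Fin n) (Fin k) ℂ => Xᴴ * A * X := by fun_prop
    exact this.matrix_elem _ _
  have hcl : IsClosed {X : Matrix (Fin n) (Fin k) ℂ |
      Xᴴ * A * X = g X • (1 : Matrix (Fin k) (Fin k) ℂ)} :=
    isClosed_eq (by fun_prop) (hg.smul continuous_const)
  have him : rankRange k A = g '' (isometries n k ∩ {X : Matrix (Fin n) (Fin k) ℂ |
      Xᴴ * A * X = g X • (1 : Matrix (Fin k) (Fin k) ℂ)}) := by
    ext z
    constructor
    · rintro ⟨X, hX, h⟩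
      have hz : g X = z := by simp [g, h]
      exact ⟨X, ⟨hX, show Xᴴ * A * X = g X • 1 by rw [hz]; exact h⟩, hz⟩
    · rintro ⟨X, ⟨hX, h⟩, rfl⟩
      exact ⟨X, hX, h⟩
  rw [him]
  exact ((isCompact_isometries n k).inter_right hcl).image hg

end KRank

end

/-! The ranges of an `X ∈ 𝒳_k` and of `M_p` have dimensions adding up to more than `n`, so they
intersect and `Λ_k(A) ⊆ F(M_p* A M_p)` (`rankRange_subset_numRange`). The first inequality follows,
since the largest modulus on a compact set is attained on its boundary.

If the second inequality fails, there are `ρ > 0` and a point of `Λ_k(A)` of modulus below `ρ` such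
that no boundary of an `F(M_p* A M_p)` meets the disc `|z| ≤ ρ`. By connectedness the disc lies in
all these sets. If their intersection is `Λ_k(A)`, then `0 ∈ Λ_k(A)`, a contradiction. If the
projections are dense, compactness carries the values of modulus `ρ` over to every subspace of
dimension at least `n - k + 1`, and `0 ∈ Λ_k(A)` follows from the half-plane description of `Λ_k`
(Li–Sze), proved with a margin in `zero_mem_rankRange_of_margin`.

For that, `0 ∈ Λ_k(A)` says that the form of `A = H + i G` vanishes on some subspace of dimension
`k`. This is a closed condition on `A` and the margin survives small perturbations, so the pencil of
`H` and `G` may be assumed to have distinct eigenvalues `μ i`. Eigenvectors are then `H`-orthogonal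
unless their eigenvalues are conjugate. Those with `Im μ < 0` span an isotropic subspace; those with
`μ` real reduce the problem to two real diagonal forms `h` and `h t`. There the pencil is rotated to
make the negative entries of `h` as few as possible. The walk formed by the signs of `h` then stays
between `0` and its final value, its steps split into alternating classes of odd size, and on each
class a divided difference kills products of polynomials of low degree. -/

noncomputable section

namespace KRank

/-! ### Isotropic subspaces from divided differences. -/

open Polynomial in
/-- Weighted evaluations of polynomials at the nodes `t j`, `j` in a class of size `2 r + 1`, span
subspaces that are isotropic for `diag h` and `diag (h t)`, by the vanishing of high divided
differences. -/
theorem exists_isotropic_of_alternating_classes {ι κ : Type*} [Fintype ι] [Fintype κ]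
    [DecidableEq ι] [DecidableEq κ] (c : ι → κ) (h t : ι → ℝ) (ht : Function.Injective t)
    (r : κ → ℕ) (hr : ∀ l, (Finset.univ.filter fun i => c i = l).card = 2 * r l + 1)
    (hpos : ∀ j, 0 < h j * ∏ i ∈ (Finset.univ.filter fun i => c i = c j).erase j, (t j - t i)) :
    ∃ L : Submodule ℂ (ι → ℂ), Module.finrank ℂ L = ∑ l, r l ∧
      ∀ x ∈ L, ∀ y ∈ L, (∑ j, (h j : ℂ) * (star (x j) * y j) = 0) ∧
        ∑ j, ((h j * t j : ℝ) : ℂ) * (star (x j) * y j) = 0 := by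
  set T : κ → Finset ι := fun l => Finset.univ.filter fun i => c i = l with hT
  set d : ι → ℝ := fun j => ∏ i ∈ (T (c j)).erase j, (t j - t i) with hd
  -- Chosen so that `h j * w j = 1 / d j` is the divided-difference weight; positivity of `w` allows
  -- the square root in `Φ`.
  set w : ι → ℝ := fun j => (h j * d j)⁻¹ with hw
  have hwpos : ∀ j, 0 < w j := fun j => inv_pos.mpr (hpos j)
  have htc : Function.Injective fun j => (t j : ℂ) := fun a b hab =>
    ht (Complex.ofReal_injective hab)
  have hh : ∀ j, h j ≠ 0 := fun j h0 => by simpa [h0] using hpos j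
  have hd0 : ∀ j, d j ≠ 0 := fun j h0 => by
    have := hpos j
    change 0 < h j * d j at this
    simp [h0] at this
  -- vanishing of the weighted sums over a class
  have hvan : ∀ l, ∀ p : ℂ[X], p.degree < ((2 * r l : ℕ) : WithBot ℕ) →
      ∑ j ∈ T l, (h j : ℂ) * (w j * p.eval (t j : ℂ)) = 0 := by
    intro l p hp
    have hcard : (T l).card = 2 * r l + 1 := hr l
    -- The divided difference on `2 r + 1` nodes is the coefficient of degree `2 r` of the
    -- interpolating polynomial, here `p` itself.
    have h1 := Lagrange.coeff_eq_sum (s := T l) (v := fun j => (t j : ℂ)) (htc.injOn) (P := p)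
      (hp.trans (by rw [hcard]; exact_mod_cast Nat.lt_succ_self _))
    rw [coeff_eq_zero_of_degree_lt (by rw [hcard]; simpa using hp)] at h1
    rw [h1]
    refine Finset.sum_congr rfl fun j hj => ?_
    have hcj : c j = l := by simpa [hT] using hj
    have : (∏ i ∈ (T l).erase j, ((t j : ℂ) - t i)) = (d j : ℂ) := by
      simp only [hd, hcj]; push_cast; rfl
    rw [this]
    have e1 : (h j : ℂ) ≠ 0 := by exact_mod_cast hh j
    have e2 : (d j : ℂ) ≠ 0 := by exact_mod_cast hd0 j
    simp only [hw]
    push_cast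
    field_simp
  let Φ : ((l : κ) → degreeLT ℂ (r l)) →ₗ[ℂ] (ι → ℂ) :=
    { toFun := fun q j => (Real.sqrt (w j) : ℂ) * ((q (c j) : ℂ[X]).eval (t j : ℂ))
      map_add' := fun p q => by ext j; simp [mul_add]
      map_smul' := fun a q => by ext j; simp; ring }
  have hΦ : Function.Injective Φ := by
    rw [← LinearMap.ker_eq_bot, LinearMap.ker_eq_bot']
    intro q hq
    funext l
    apply Subtype.ext
    change (q l : ℂ[X]) = 0
    refine eq_zero_of_degree_lt_of_eval_index_eq_zero (s := T l) (v := fun j => (t j : ℂ))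
      htc.injOn ?_ ?_
    · refine (mem_degreeLT.mp (q l).2).trans_le ?_
      rw [show (T l).card = 2 * r l + 1 from hr l]
      exact_mod_cast (by omega : r l ≤ 2 * r l + 1)
    · intro j hj
      have hcj : c j = l := by simpa [hT] using hj
      have := congrFun hq j
      simp only [Φ, LinearMap.coe_mk, AddHom.coe_mk, Pi.zero_apply, mul_eq_zero] at this
      rcases this with h0 | h0
      · exact absurd h0 (by exact_mod_cast (Real.sqrt_pos.mpr (hwpos j)).ne')
      · rw [← hcj]; exact h0
  refine ⟨LinearMap.range Φ, ?_, ?_⟩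
  · rw [LinearMap.finrank_range_of_inj hΦ, Module.finrank_pi_fintype]
    refine Finset.sum_congr rfl fun l _ => ?_
    rw [(degreeLTEquiv ℂ (r l)).finrank_eq, Module.finrank_fin_fun]
  · rintro _ ⟨p, rfl⟩ _ ⟨q, rfl⟩
    have hprod : ∀ j, star (Φ p j) * Φ q j =
        w j * (((p (c j) : ℂ[X]).map (starRingEnd ℂ)) * (q (c j) : ℂ[X])).eval (t j : ℂ) := by
      intro j
      have h1 : ((p (c j) : ℂ[X]).map (starRingEnd ℂ)).eval (t j : ℂ) =
          star ((p (c j) : ℂ[X]).eval (t j : ℂ)) := by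
        have := eval_map_apply (starRingEnd ℂ) (p := (p (c j) : ℂ[X])) (t j : ℂ)
        rwa [Complex.conj_ofReal] at this
      have h2 : ((Real.sqrt (w j) : ℂ)) * (Real.sqrt (w j) : ℂ) = w j := by
        exact_mod_cast Real.mul_self_sqrt (hwpos j).le
      rw [eval_mul, h1, ← h2]
      simp only [Φ, LinearMap.coe_mk, AddHom.coe_mk, star_mul', RCLike.star_def,
        Complex.conj_ofReal]
      ring
    -- The strict bound with `+ 1` leaves room for the factor `X` that represents `t` in the second
    -- form.
    have hdeg : ∀ l, (((p l : ℂ[X]).map (starRingEnd ℂ)) * (q l : ℂ[X]) = 0) ∨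
        (((p l : ℂ[X]).map (starRingEnd ℂ)) * (q l : ℂ[X])).natDegree + 1 < 2 * r l := by
      intro l
      by_cases hp0 : (p l : ℂ[X]) = 0
      · left; simp [hp0]
      by_cases hq0 : (q l : ℂ[X]) = 0
      · left; simp [hq0]
      right
      have h1 := mem_degreeLT.mp (p l).2
      have h2 := mem_degreeLT.mp (q l).2
      rw [← natDegree_lt_iff_degree_lt hp0] at h1
      rw [← natDegree_lt_iff_degree_lt hq0] at h2
      have := natDegree_mul_le (p := (p l : ℂ[X]).map (starRingEnd ℂ)) (q := (q l : ℂ[X]))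
      rw [natDegree_map] at this
      omega
    have hfib : ∀ f : ι → ℂ, ∑ j, f j = ∑ l, ∑ j ∈ T l, f j := fun f =>
      (Finset.sum_fiberwise Finset.univ c f).symm
    constructor
    · rw [hfib]
      refine Finset.sum_eq_zero fun l _ => ?_
      rw [← hvan l (((p l : ℂ[X]).map (starRingEnd ℂ)) * (q l : ℂ[X]))]
      · refine Finset.sum_congr rfl fun j hj => ?_
        have hcj : c j = l := by simpa [hT] using hj
        rw [hprod, hcj]
      · rcases hdeg l with h0 | h0
        · rw [h0, degree_zero]; exact WithBot.bot_lt_coe _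
        · exact degree_le_natDegree.trans_lt (by exact_mod_cast (by omega))
    · rw [hfib]
      refine Finset.sum_eq_zero fun l _ => ?_
      rw [← hvan l (X * (((p l : ℂ[X]).map (starRingEnd ℂ)) * (q l : ℂ[X])))]
      · refine Finset.sum_congr rfl fun j hj => ?_
        have hcj : c j = l := by simpa [hT] using hj
        rw [hprod, hcj, eval_mul (p := X), eval_X]
        push_cast
        ring
      · rcases hdeg l with h0 | h0
        · rw [h0, mul_zero, degree_zero]; exact WithBot.bot_lt_coe _
        · refine degree_le_natDegree.trans_lt ?_
          have := natDegree_mul_le (p := (X : ℂ[X]))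
            (q := (p l : ℂ[X]).map (starRingEnd ℂ) * (q l : ℂ[X]))
          rw [natDegree_X] at this
          exact_mod_cast (by omega)

theorem sign_prod_sub_pos {ι : Type*} [DecidableEq ι] (t : ι → ℝ) (x : ℝ) (s : Finset ι)
    (hs : ∀ i ∈ s, t i ≠ x) :
    0 < (-1 : ℝ) ^ (s.filter fun i => x < t i).card * ∏ i ∈ s, (x - t i) := by
  induction s using Finset.induction_on with
  | empty => simp
  | insert a s ha ih =>
    have ih' := ih fun i hi => hs i (Finset.mem_insert_of_mem hi)
    rw [Finset.prod_insert ha, Finset.filter_insert]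
    rcases lt_or_gt_of_ne (hs a (Finset.mem_insert_self a s)) with h1 | h1
    · rw [if_neg (not_lt.mpr h1.le)]
      nlinarith [mul_pos (sub_pos.mpr h1) ih']
    · rw [if_pos h1, Finset.card_insert_of_notMem (by simp [ha]), pow_succ]
      nlinarith [mul_pos (sub_pos.mpr h1) ih']

/-! ### The walk of signs and its level classes. -/

/-- The partial sum of the signs `ε` over the nodes below that of `j`. -/
def partialSum {ι : Type*} [Fintype ι] (t : ι → ℝ) (ε : ι → ℤ) (j : ι) : ℤ :=
  ∑ i ∈ Finset.univ.filter (fun i => t i < t j), ε i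

/-- The lower end of the step that the partial sums make at `j`. -/
def level {ι : Type*} [Fintype ι] (t : ι → ℝ) (ε : ι → ℤ) (j : ι) : ℤ :=
  min (partialSum t ε j) (partialSum t ε j + ε j)

/-- A walk starting at `0` crosses between `l` and `l + 1` an odd number of times exactly when it
ends above `l`. The set `s` is an initial segment of the nodes, and the induction adds its last
node. -/
theorem card_level_mod_two {ι : Type*} [Fintype ι] [DecidableEq ι] (t : ι → ℝ)
    (ht : Function.Injective t) (ε : ι → ℤ) (hε : ∀ i, ε i = 1 ∨ ε i = -1) (l : ℤ) (hl : 0 ≤ l)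
    (s : Finset ι) (hs : ∀ i ∈ s, ∀ j, t j < t i → j ∈ s) :
    (s.filter fun i => level t ε i = l).card % 2 = if l < ∑ i ∈ s, ε i then 1 else 0 := by
  induction s using Finset.induction_on_max_value t with
  | empty => simp [not_lt.mpr hl]
  | insert a s ha hmax ih =>
    have hs' : ∀ i ∈ s, ∀ j, t j < t i → j ∈ s := by
      intro i hi j hj
      rcases Finset.mem_insert.mp (hs i (Finset.mem_insert_of_mem hi) j hj) with h1 | h1
      · subst h1; exact absurd hj (not_lt.mpr (hmax i hi))
      · exact h1
    have ih' := ih hs'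
    have hbelow : Finset.univ.filter (fun i => t i < t a) = s := by
      ext i
      simp only [Finset.mem_filter, Finset.mem_univ, true_and]
      constructor
      · intro hi
        rcases Finset.mem_insert.mp (hs a (Finset.mem_insert_self a s) i hi) with h1 | h1
        · subst h1; exact absurd hi (lt_irrefl _)
        · exact h1
      · intro hi
        exact lt_of_le_of_ne (hmax i hi) fun h1 => ha (ht h1 ▸ hi)
    have hps : partialSum t ε a = ∑ i ∈ s, ε i := by rw [partialSum, hbelow]
    rw [Finset.filter_insert, Finset.sum_insert ha]
    have hlev : level t ε a = min (∑ i ∈ s, ε i) (∑ i ∈ s, ε i + ε a) := by rw [level, hps]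
    rw [hlev]
    generalize ∑ i ∈ s, ε i = S at ih' ⊢
    have hnm : a ∉ s.filter fun i => level t ε i = l := by simp [ha]
    split_ifs with h1 h2 h2
    · rw [Finset.card_insert_of_notMem hnm]
      split_ifs at ih' <;> rcases hε a with h | h <;> rw [h] at h1 h2 <;> omega
    · rw [Finset.card_insert_of_notMem hnm]
      split_ifs at ih' <;> rcases hε a with h | h <;> rw [h] at h1 h2 <;> omega
    · split_ifs at ih' <;> rcases hε a with h | h <;> rw [h] at h1 h2 <;> omega
    · split_ifs at ih' <;> rcases hε a with h | h <;> rw [h] at h1 h2 <;> omega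

/-- If the partial sums of the signs of `h` (in the order of `t`) stay between `0` and their final
value, then `diag h` and `diag (h t)` have a common isotropic subspace whose dimension is the
number of negative signs. -/
theorem exists_isotropic_of_partialSum_bounds {ι : Type*} [Fintype ι] [DecidableEq ι] (h t : ι → ℝ)
    (ht : Function.Injective t) (ε : ι → ℤ) (hε : ∀ i, ε i = 1 ∨ ε i = -1)
    (hsign : ∀ i, 0 < (ε i : ℝ) * h i)
    (h0 : ∀ j, 0 ≤ partialSum t ε j) (h1 : ∀ j, 0 ≤ partialSum t ε j + ε j)
    (h2 : ∀ j, partialSum t ε j ≤ ∑ i, ε i) (h3 : ∀ j, partialSum t ε j + ε j ≤ ∑ i, ε i)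
    (hD : 0 ≤ ∑ i, ε i) :
    ∃ L : Submodule ℂ (ι → ℂ),
      Module.finrank ℂ L = (Finset.univ.filter fun i => h i < 0).card ∧
      ∀ x ∈ L, ∀ y ∈ L, (∑ j, (h j : ℂ) * (star (x j) * y j) = 0) ∧
        ∑ j, ((h j * t j : ℝ) : ℂ) * (star (x j) * y j) = 0 := by
  obtain ⟨D, hDD⟩ := Int.eq_ofNat_of_zero_le hD
  have hlev0 : ∀ j, 0 ≤ level t ε j := fun j => le_min (h0 j) (h1 j)
  have hlevD : ∀ j, level t ε j < D := by
    intro j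
    have := h2 j; have := h3 j
    rw [level, min_lt_iff]
    rcases hε j with h | h <;> rw [h] at this <;> omega
  let c : ι → Fin D := fun j => ⟨(level t ε j).toNat, by have := hlev0 j; have := hlevD j; omega⟩
  have hc : ∀ (l : Fin D) i, c i = l ↔ level t ε i = (l : ℕ) := by
    intro l i
    have := hlev0 i
    simp only [c, Fin.ext_iff]
    omega
  have hclass : ∀ l : Fin D, (Finset.univ.filter fun i => c i = l) =
      Finset.univ.filter fun i => level t ε i = ((l : ℕ) : ℤ) := fun l => by
    ext i; simp [hc]
  have hodd : ∀ l : Fin D, (Finset.univ.filter fun i => c i = l).card % 2 = 1 := by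
    intro l
    rw [hclass, card_level_mod_two t ht ε hε l (by omega) Finset.univ (by simp), if_pos]
    rw [hDD]; exact_mod_cast l.2
  obtain ⟨L, hL, hiso⟩ := exists_isotropic_of_alternating_classes c h t ht
    (fun l => (Finset.univ.filter fun i => c i = l).card / 2)
    (fun l => by have := hodd l; omega) (by
      intro j
      set T := Finset.univ.filter fun i => c i = c j with hT
      have hjT : j ∈ T := by simp [hT]
      have hprod := sign_prod_sub_pos t (t j) (T.erase j) fun i hi h =>
        (Finset.mem_erase.mp hi).1 (ht h)
      set up := ((T.erase j).filter fun i => t j < t i).card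
      -- Crossings of one level alternate, the first being upward, so an up step has an even number
      -- of predecessors in its class. The class being odd, the number `up` of successors has the
      -- same parity, and `(-1) ^ up`, the sign of the node product, is `ε j`.
      have hlow : (T.filter fun i => t i < t j).card % 2 = if ε j = 1 then 0 else 1 := by
        have e1 : T.filter (fun i => t i < t j) =
            (Finset.univ.filter fun i => t i < t j).filter
              fun i => level t ε i = level t ε j := by
          ext i
          simp only [hT, Finset.mem_filter, Finset.mem_univ, true_and, hc (c j) i,
            ← (hc (c j) j).mp rfl]
          exact and_comm
        rw [e1, card_level_mod_two t ht ε hε _ (hlev0 j) _ (by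
          intro i hi k hk
          simp only [Finset.mem_filter, Finset.mem_univ, true_and] at *
          exact hk.trans hi)]
        change (if level t ε j < partialSum t ε j then 1 else 0) = _
        rw [level]
        rcases hε j with h | h <;> rw [h] <;> simp
      have hsplit : T.card = (T.filter fun i => t i < t j).card + up + 1 := by
        rw [← Finset.card_erase_add_one hjT,
          ← Finset.card_filter_add_card_filter_not (s := T.erase j) (fun i => t i < t j)]
        have e1 : (T.erase j).filter (fun i => t i < t j) = T.filter fun i => t i < t j := by
          ext i
          simp only [Finset.mem_filter, Finset.mem_erase]
          constructor
          · rintro ⟨⟨_, a⟩, b⟩; exact ⟨a, b⟩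
          · rintro ⟨a, b⟩; exact ⟨⟨fun e => by subst e; exact lt_irrefl _ b, a⟩, b⟩
        have e2 : (T.erase j).filter (fun i => ¬ t i < t j) =
            (T.erase j).filter fun i => t j < t i := by
          refine Finset.filter_congr fun i hi => ?_
          have hne : t i ≠ t j := fun h => (Finset.mem_erase.mp hi).1 (ht h)
          constructor
          · intro a; exact lt_of_le_of_ne (not_lt.mp a) hne.symm
          · intro a; exact not_lt.mpr a.le
        rw [e1, e2]
      have hTodd : T.card % 2 = 1 := hodd (c j)
      have hs := hsign j
      rcases hε j with h | h
      · rw [h] at hlow hs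
        have : Even up := Nat.even_iff.mpr (by simp at hlow; omega)
        rw [this.neg_one_pow] at hprod
        simp only [Int.cast_one, one_mul] at hs hprod
        exact mul_pos hs hprod
      · rw [h] at hlow hs
        have : Odd up := Nat.odd_iff.mpr (by simp at hlow; omega)
        rw [this.neg_one_pow] at hprod
        push_cast at hs
        nlinarith [mul_pos hs hprod])
  refine ⟨L, ?_, hiso⟩
  rw [hL]
  have hneg : ∀ i, h i < 0 ↔ ε i = -1 := by
    intro i
    have := hsign i
    rcases hε i with h | h <;> rw [h] at this <;> simp only [h] <;> push_cast at this
    · constructor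
      · intro; linarith
      · intro; omega
    · constructor
      · intro; trivial
      · intro; linarith
  -- With `N` nodes and `r l` half the size of class `l` rounded down, both `N - D = 2 * (number of
  -- negative signs)` and `N - D = 2 * ∑ r l`.
  have hcount : ∑ i, ε i + 2 * ((Finset.univ.filter fun i => h i < 0).card : ℤ) =
      Fintype.card ι := by
    rw [Finset.card_filter, ← Finset.card_univ, Finset.card_eq_sum_ones]
    push_cast
    rw [Finset.mul_sum, ← Finset.sum_add_distrib]
    refine Finset.sum_congr rfl fun i _ => ?_
    have := hneg i
    rcases hε i with h | h <;> simp [this, h]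
  have hsum : ∑ l : Fin D, (Finset.univ.filter fun i => c i = l).card = Fintype.card ι := by
    rw [← Finset.card_univ, Finset.card_eq_sum_card_fiberwise (f := c) (t := Finset.univ)]
    simp
  have hsum2 : ∑ l : Fin D, (Finset.univ.filter fun i => c i = l).card =
      2 * (∑ l : Fin D, (Finset.univ.filter fun i => c i = l).card / 2) + D := by
    rw [Finset.mul_sum]
    have hone : D = ∑ _l : Fin D, 1 := by simp
    conv_rhs => enter [2]; rw [hone]
    rw [← Finset.sum_add_distrib]
    refine Finset.sum_congr rfl fun l _ => ?_
    have := hodd l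
    omega
  omega

/-! ### Bounding the walk by minimality of the negative count. -/

theorem exists_lt_gap {ι : Type*} [Finite ι] (t : ι → ℝ) (x : ℝ) :
    ∃ τ < x, ∀ i, t i < x → t i < τ := by
  have h1 : ∀ᶠ τ in nhdsWithin x (Set.Iio x), ∀ i, t i < x → t i < τ := by
    rw [Filter.eventually_all]
    intro i
    by_cases hi : t i < x
    · filter_upwards [Ioo_mem_nhdsLT hi] with τ hτ _ using hτ.1
    · exact Filter.Eventually.of_forall fun _ h => absurd h hi
  obtain ⟨τ, h2, h3⟩ := (h1.and self_mem_nhdsWithin).exists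
  exact ⟨τ, h3, h2⟩

theorem exists_gt_gap {ι : Type*} [Finite ι] (t : ι → ℝ) (x : ℝ) :
    ∃ τ > x, ∀ i, x < t i → τ < t i := by
  obtain ⟨τ, h1, h2⟩ := exists_lt_gap (fun i => -t i) (-x)
  exact ⟨-τ, by linarith, fun i hi => by have := h2 i (by linarith); linarith⟩

/-- If turning the form `diag h` into any `diag (h (c + s t))` with nonvanishing entries does not
decrease the number of negative entries, the partial sums of the signs of `h` are bounded as
required in `exists_isotropic_of_partialSum_bounds`. -/
theorem exists_isotropic_of_card_neg_minimal {ι : Type*} [Fintype ι] (h t : ι → ℝ)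
    (hh : ∀ i, h i ≠ 0) (ht : Function.Injective t)
    (hmin : ∀ c s : ℝ, (c ≠ 0 ∨ s ≠ 0) → (∀ i, c + s * t i ≠ 0) →
      (Finset.univ.filter fun i => h i < 0).card ≤
        (Finset.univ.filter fun i => h i * (c + s * t i) < 0).card) :
    ∃ L : Submodule ℂ (ι → ℂ),
      Module.finrank ℂ L = (Finset.univ.filter fun i => h i < 0).card ∧
      ∀ x ∈ L, ∀ y ∈ L, (∑ j, (h j : ℂ) * (star (x j) * y j) = 0) ∧
        ∑ j, ((h j * t j : ℝ) : ℂ) * (star (x j) * y j) = 0 := by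
  classical
  let ε : ι → ℤ := fun i => if 0 < h i then 1 else -1
  -- Multiplying `h` by `t - τ` flips the signs below `τ`, and by `τ - t` those above. The negative
  -- count grows by the sum of the flipped signs, which minimality makes nonnegative.
  have hcut : ∀ τ : ℝ, (∀ i, t i ≠ τ) →
      0 ≤ ∑ i ∈ Finset.univ.filter (fun i => t i < τ), ε i ∧
      ∑ i ∈ Finset.univ.filter (fun i => t i < τ), ε i ≤ ∑ i, ε i := by
    intro τ hτ
    have hA := hmin (-τ) 1 (Or.inr one_ne_zero) fun i h0 => hτ i (by linarith)
    have hB := hmin τ (-1) (Or.inr (by norm_num)) fun i h0 => hτ i (by linarith)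
    have e1 : ((Finset.univ.filter fun i => h i < 0).card : ℤ) +
        ∑ i ∈ Finset.univ.filter (fun i => t i < τ), ε i =
        (Finset.univ.filter fun i => h i * (-τ + 1 * t i) < 0).card := by
      rw [Finset.card_filter, Finset.card_filter, Finset.sum_filter]
      push_cast
      rw [← Finset.sum_add_distrib]
      refine Finset.sum_congr rfl fun i _ => ?_
      rcases lt_or_gt_of_ne (hh i) with a | a <;> rcases lt_or_gt_of_ne (hτ i) with b | b
      · have : 0 < h i * (-τ + 1 * t i) := by nlinarith
        simp only [ε, if_pos a, if_neg (not_lt.mpr a.le), if_pos b, if_neg (not_lt.mpr this.le)]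
        rfl
      · have : h i * (-τ + 1 * t i) < 0 := by nlinarith
        simp only [if_pos a, if_neg (not_lt.mpr b.le), if_pos this]; rfl
      · have : h i * (-τ + 1 * t i) < 0 := by nlinarith
        simp only [ε, if_pos a, if_neg (not_lt.mpr a.le), if_pos b, if_pos this]; rfl
      · have : 0 < h i * (-τ + 1 * t i) := by nlinarith
        simp only [if_neg (not_lt.mpr a.le), if_neg (not_lt.mpr b.le), if_neg (not_lt.mpr this.le)]
        rfl
    have e2 : ((Finset.univ.filter fun i => h i < 0).card : ℤ) + ∑ i, ε i =
        (Finset.univ.filter fun i => h i * (τ + -1 * t i) < 0).card +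
        ∑ i ∈ Finset.univ.filter (fun i => t i < τ), ε i := by
      rw [Finset.card_filter, Finset.card_filter, Finset.sum_filter]
      push_cast
      rw [← Finset.sum_add_distrib, ← Finset.sum_add_distrib]
      refine Finset.sum_congr rfl fun i _ => ?_
      rcases lt_or_gt_of_ne (hh i) with a | a <;> rcases lt_or_gt_of_ne (hτ i) with b | b
      · have : h i * (τ + -1 * t i) < 0 := by nlinarith
        simp only [if_pos a, if_pos b, if_pos this]
      · have : 0 < h i * (τ + -1 * t i) := by nlinarith
        simp only [ε, if_pos a, if_neg (not_lt.mpr a.le), if_neg (not_lt.mpr b.le),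
          if_neg (not_lt.mpr this.le)]
        rfl
      · have : 0 < h i * (τ + -1 * t i) := by nlinarith
        simp only [if_neg (not_lt.mpr a.le), if_pos b, if_neg (not_lt.mpr this.le)]
      · have : h i * (τ + -1 * t i) < 0 := by nlinarith
        simp only [ε, if_pos a, if_neg (not_lt.mpr a.le), if_neg (not_lt.mpr b.le), if_pos this]
        rfl
    constructor <;> omega
  have hbelow : ∀ j, 0 ≤ partialSum t ε j ∧ partialSum t ε j ≤ ∑ i, ε i := by
    intro j
    obtain ⟨τ, h1, h2⟩ := exists_lt_gap t (t j)
    have e : Finset.univ.filter (fun i => t i < t j) = Finset.univ.filter fun i => t i < τ :=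
      Finset.filter_congr fun i _ => ⟨h2 i, fun h => h.trans h1⟩
    rw [partialSum, e]
    exact hcut τ fun i hi => (lt_irrefl τ) (by
      have := h2 i (hi ▸ h1); rwa [hi] at this)
  have habove : ∀ j, 0 ≤ partialSum t ε j + ε j ∧ partialSum t ε j + ε j ≤ ∑ i, ε i := by
    intro j
    obtain ⟨τ, h1, h2⟩ := exists_gt_gap t (t j)
    have e : Finset.univ.filter (fun i => t i < τ) =
        insert j (Finset.univ.filter fun i => t i < t j) := by
      ext i
      simp only [Finset.mem_filter, Finset.mem_univ, true_and, Finset.mem_insert]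
      constructor
      · intro hi
        rcases lt_trichotomy (t i) (t j) with a | a | a
        · exact Or.inr a
        · exact Or.inl (ht a)
        · exact absurd hi (not_lt.mpr (h2 i a).le)
      · rintro (rfl | hi)
        · exact h1
        · exact hi.trans h1
    have := hcut τ fun i hi => (lt_irrefl τ) (by
      have := h2 i (hi ▸ h1); rwa [hi] at this)
    rw [e, Finset.sum_insert (by simp), add_comm] at this
    exact this
  refine exists_isotropic_of_partialSum_bounds h t ht ε (fun i => ?_) (fun i => ?_)
    (fun j => (hbelow j).1) (fun j => (habove j).1) (fun j => (hbelow j).2)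
    (fun j => (habove j).2) ?_
  · simp only [ε]; split_ifs <;> simp
  · simp only [ε]
    split_ifs with a
    · simpa using a
    · have := lt_of_le_of_ne (not_lt.mp a) (hh i)
      push_cast; linarith
  · rcases isEmpty_or_nonempty ι with hι | ⟨⟨j⟩⟩
    · simp
    · exact (hbelow j).1.trans (hbelow j).2

/-- Rotating the pair `(h, h t)` changes neither its common isotropic subspaces nor the family of
its real combinations. So `h` may be replaced by the combination with fewest negative entries; these
are the positive entries of the opposite combination, hence at least `k`. -/
theorem exists_isotropic_of_forall_le_card_pos {ι : Type*} [Fintype ι] (h t : ι → ℝ)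
    (hh : ∀ i, h i ≠ 0) (ht : Function.Injective t) (k : ℕ)
    (hk : ∀ c s : ℝ, (c ≠ 0 ∨ s ≠ 0) →
      k ≤ (Finset.univ.filter fun i => 0 < h i * (c + s * t i)).card) :
    ∃ L : Submodule ℂ (ι → ℂ), k ≤ Module.finrank ℂ L ∧
      ∀ x ∈ L, ∀ y ∈ L, (∑ j, (h j : ℂ) * (star (x j) * y j) = 0) ∧
        ∑ j, ((h j * t j : ℝ) : ℂ) * (star (x j) * y j) = 0 := by
  classical
  let N : ℝ → ℝ → ℕ := fun c s => (Finset.univ.filter fun i => h i * (c + s * t i) < 0).card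
  have hex : ∃ m c s, (c ≠ 0 ∨ s ≠ 0) ∧ (∀ i, c + s * t i ≠ 0) ∧ N c s = m :=
    ⟨_, 1, 0, Or.inl one_ne_zero, fun i => by simp, rfl⟩
  obtain ⟨c₀, s₀, hcs, hgen, hN⟩ := Nat.find_spec hex
  have hmin : ∀ c s, (c ≠ 0 ∨ s ≠ 0) → (∀ i, c + s * t i ≠ 0) → N c₀ s₀ ≤ N c s :=
    fun c s h1 h2 => hN.trans_le (Nat.find_min' hex ⟨c, s, h1, h2, rfl⟩)
  have hnorm : 0 < c₀ ^ 2 + s₀ ^ 2 := by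
    rcases hcs with a | a <;> positivity
  let h' : ι → ℝ := fun i => h i * (c₀ + s₀ * t i)
  -- The ratio of the two rotated forms: a Möbius image of `t` with determinant `c₀ ^ 2 + s₀ ^ 2`,
  -- hence still injective.
  let t' : ι → ℝ := fun i => (-s₀ + c₀ * t i) / (c₀ + s₀ * t i)
  have hmul : ∀ i (c s : ℝ), h' i * (c + s * t' i) =
      h i * ((c * c₀ - s * s₀) + (c * s₀ + s * c₀) * t i) := by
    intro i c s
    have := hgen i
    simp only [h', t']
    field_simp
    ring
  have ht' : Function.Injective t' := by
    intro i j hij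
    simp only [t'] at hij
    rw [div_eq_div_iff (hgen i) (hgen j)] at hij
    have : (c₀ ^ 2 + s₀ ^ 2) * (t i - t j) = 0 := by linear_combination hij
    rcases mul_eq_zero.mp this with a | a
    · exact absurd a hnorm.ne'
    · exact ht (by linarith)
  obtain ⟨L, hL, hiso⟩ := exists_isotropic_of_card_neg_minimal h' t'
    (fun i => mul_ne_zero (hh i) (hgen i)) ht' (by
      intro c s h1 h2
      have h3 := hmin (c * c₀ - s * s₀) (c * s₀ + s * c₀) (by
        by_contra! h4
        have : (c ^ 2 + s ^ 2) * (c₀ ^ 2 + s₀ ^ 2) = 0 := by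
          linear_combination (c * c₀ - s * s₀) * h4.1 + (c * s₀ + s * c₀) * h4.2
        rcases mul_eq_zero.mp this with a | a
        · have : 0 < c ^ 2 + s ^ 2 := by rcases h1 with b | b <;> positivity
          exact this.ne' a
        · exact hnorm.ne' a) (by
        intro i h0
        have := hmul i c s
        rw [h0, mul_zero] at this
        exact mul_ne_zero (mul_ne_zero (hh i) (hgen i)) (h2 i) this)
      simp only [N] at h3
      simp only [hmul]
      exact h3)
  refine ⟨L, ?_, fun x hx y hy => ?_⟩
  · rw [hL]
    have := hk (-c₀) (-s₀) (by simpa using hcs)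
    refine this.trans_eq (congrArg Finset.card (Finset.filter_congr fun i _ => ?_))
    simp only [h']
    constructor <;> intro a <;> nlinarith
  · obtain ⟨e1, e2⟩ := hiso x hx y hy
    have hne : ((c₀ ^ 2 + s₀ ^ 2 : ℝ) : ℂ) ≠ 0 := by exact_mod_cast hnorm.ne'
    have e3 : ∀ j, h' j * t' j = h j * (-s₀ + c₀ * t j) := by
      intro j
      have := hgen j
      simp only [h', t']
      field_simp
    simp only [e3] at e2
    constructor
    · refine (mul_eq_zero.mp ?_).resolve_left hne
      calc _ = c₀ * (∑ j, (h' j : ℂ) * (star (x j) * y j)) -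
            s₀ * ∑ j, ((h j * (-s₀ + c₀ * t j) : ℝ) : ℂ) * (star (x j) * y j) := by
            rw [Finset.mul_sum, Finset.mul_sum, Finset.mul_sum, ← Finset.sum_sub_distrib]
            refine Finset.sum_congr rfl fun j _ => ?_
            simp only [h']; push_cast; ring
        _ = 0 := by rw [e1, e2]; simp
    · refine (mul_eq_zero.mp ?_).resolve_left hne
      calc _ = s₀ * (∑ j, (h' j : ℂ) * (star (x j) * y j)) +
            c₀ * ∑ j, ((h j * (-s₀ + c₀ * t j) : ℝ) : ℂ) * (star (x j) * y j) := by
            rw [Finset.mul_sum, Finset.mul_sum, Finset.mul_sum, ← Finset.sum_add_distrib]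
            refine Finset.sum_congr rfl fun j _ => ?_
            simp only [h']; push_cast; ring
        _ = 0 := by rw [e1, e2]; simp

/-! ### Hermitian pencils with distinct eigenvalues. -/

theorem star_dotProduct_mulVec_sum {ι m : Type*} [Fintype ι] [Fintype m] (A : Matrix m m ℂ)
    (v : ι → m → ℂ) (x y : ι → ℂ) :
    star (∑ i, x i • v i) ⬝ᵥ (A *ᵥ ∑ j, y j • v j) =
      ∑ i, ∑ j, star (x i) * y j * (star (v i) ⬝ᵥ (A *ᵥ v j)) := by
  rw [star_sum, sum_dotProduct]
  refine Finset.sum_congr rfl fun i _ => ?_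
  rw [Matrix.mulVec_sum, dotProduct_sum]
  refine Finset.sum_congr rfl fun j _ => ?_
  rw [star_smul, smul_dotProduct, Matrix.mulVec_smul, dotProduct_smul]
  simp only [smul_eq_mul]
  ring

theorem star_star_dotProduct_mulVec {m : Type*} [Fintype m] {H : Matrix m m ℂ}
    (hH : H.IsHermitian) (x y : m → ℂ) :
    star (star x ⬝ᵥ (H *ᵥ y)) = star y ⬝ᵥ (H *ᵥ x) := by
  rw [Matrix.star_dotProduct, star_star, Matrix.star_mulVec, hH.eq, ← Matrix.dotProduct_mulVec]

open ComplexOrder in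
/-- Isotropic subspaces of `H + i G` when the pencil of `H` and `G` has simple eigenvalues. -/
theorem exists_isotropic_of_simple_pencil {ι : Type*} [Fintype ι] [DecidableEq ι]
    {H G : Matrix ι ι ℂ} (hH : H.IsHermitian) (hG : G.IsHermitian) (hdet : IsUnit H.det)
    (μ : ι → ℂ) (hμ : Function.Injective μ) (v : ι → ι → ℂ) (hv0 : ∀ i, v i ≠ 0)
    (hv : ∀ i, G *ᵥ v i = μ i • (H *ᵥ v i)) (k : ℕ)
    (hk : ∀ V : Submodule ℂ (ι → ℂ), Fintype.card ι < Module.finrank ℂ V + k →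
      ∀ c s : ℝ, (c ≠ 0 ∨ s ≠ 0) → ∃ x ∈ V,
        0 < (((c : ℂ) - s * Complex.I) * (star x ⬝ᵥ ((H + Complex.I • G) *ᵥ x))).re) :
    ∃ L : Submodule ℂ (ι → ℂ), k ≤ Module.finrank ℂ L ∧
      ∀ x ∈ L, ∀ y ∈ L, star x ⬝ᵥ ((H + Complex.I • G) *ᵥ y) = 0 := by
  have hli : LinearIndependent ℂ v := by
    refine Module.End.eigenvectors_linearIndependent' (Matrix.toLin' (H⁻¹ * G)) μ hμ v fun i => ?_
    refine ⟨Module.End.mem_eigenspace_iff.mpr ?_, hv0 i⟩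
    rw [Matrix.toLin'_apply, ← Matrix.mulVec_mulVec, hv, Matrix.mulVec_smul, Matrix.mulVec_mulVec,
      Matrix.nonsing_inv_mul _ hdet, Matrix.one_mulVec]
  set η : ι → ι → ℂ := fun i j => star (v i) ⬝ᵥ (H *ᵥ v j) with hη
  have hηstar : ∀ i j, star (η i j) = η j i := fun i j => star_star_dotProduct_mulVec hH _ _
  have horth : ∀ i j, η i j ≠ 0 → μ j = star (μ i) := by
    intro i j hij
    have h1 : star (v i) ⬝ᵥ (G *ᵥ v j) = μ j * η i j := by
      rw [hv, dotProduct_smul, smul_eq_mul]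
    have h2 : star (v i) ⬝ᵥ (G *ᵥ v j) = star (μ i) * η i j := by
      rw [← star_star_dotProduct_mulVec hG, hv, dotProduct_smul, smul_eq_mul, star_mul', hηstar]
    exact mul_right_cancel₀ hij (h1.symm.trans h2)
  have hα : ∀ i j, star (v i) ⬝ᵥ ((H + Complex.I • G) *ᵥ v j) =
      (1 + Complex.I * μ j) * η i j := by
    intro i j
    rw [Matrix.add_mulVec, Matrix.smul_mulVec, hv, dotProduct_add, dotProduct_smul,
      dotProduct_smul]
    simp only [smul_eq_mul, hη]
    ring
  let Φ : (ι → ℂ) →ₗ[ℂ] (ι → ℂ) := Fintype.linearCombination ℂ v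
  have hΦ : Function.Injective Φ := hli.fintypeLinearCombination_injective
  have hΦsum : ∀ x, Φ x = ∑ i, x i • v i := fun x => Fintype.linearCombination_apply ℂ v x
  -- When the supports contain no conjugate pair of nonreal eigenvalues, only the diagonal terms at
  -- real eigenvalues survive.
  have hform : ∀ x y : ι → ℂ,
      (∀ i j, x i ≠ 0 → y j ≠ 0 → μ j = star (μ i) → (μ i).im = 0) →
      star (Φ x) ⬝ᵥ ((H + Complex.I • G) *ᵥ Φ y) =
        ∑ i : {i // (μ i).im = 0}, (1 + Complex.I * μ i) * η i i * (star (x i) * y i) := by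
    intro x y hxy
    rw [hΦsum, hΦsum, star_dotProduct_mulVec_sum]
    simp only [hα]
    rw [← Finset.sum_subtype (Finset.univ.filter fun i => (μ i).im = 0) (by simp)
      fun i => (1 + Complex.I * μ i) * η i i * (star (x i) * y i), Finset.sum_filter]
    refine Finset.sum_congr rfl fun i _ => ?_
    rw [Finset.sum_eq_single i]
    · split_ifs with him
      · ring
      · by_cases h0 : η i i = 0
        · simp [h0]
        by_cases hx : x i = 0
        · simp [hx]
        by_cases hy : y i = 0
        · simp [hy]
        exact absurd (hxy i i hx hy (horth i i h0)) him
    · intro j _ hji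
      by_cases h0 : η i j = 0
      · simp [h0]
      by_cases hx : x i = 0
      · simp [hx]
      by_cases hy : y j = 0
      · simp [hy]
      have h1 := horth i j h0
      have h2 := Complex.conj_eq_iff_im.mpr (hxy i j hx hy h1)
      exact absurd (hμ (h1.trans h2)) hji
    · simp
  let h : {i // (μ i).im = 0} → ℝ := fun i => (η i i).re
  let t : {i // (μ i).im = 0} → ℝ := fun i => (μ i).re
  have hμt : ∀ i : {i // (μ i).im = 0}, μ i = t i := fun i =>
    Complex.ext (by simp [t]) (by simp [i.2])
  have hηh : ∀ i : {i // (μ i).im = 0}, η i i = h i := fun i =>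
    (Complex.conj_eq_iff_re.mp (hηstar i i)).symm
  have ht : Function.Injective t := fun i j hij =>
    Subtype.ext (hμ (by rw [hμt, hμt, hij]))
  have hh : ∀ i, h i ≠ 0 := by
    intro i h0
    -- If `h i = 0`, then `H *ᵥ v i` is orthogonal to the whole eigenbasis, so it is zero, against
    -- the invertibility of `H`.
    have h1 : ∀ j, star (v j) ⬝ᵥ (H *ᵥ v i) = 0 := by
      intro j
      by_contra h2
      have h3 := horth j i h2
      have h4 : j = (i : ι) := by
        apply hμ
        rw [← star_star (μ j), ← h3, hμt]
        exact Complex.conj_ofReal _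
      subst h4
      exact h2 (by have := hηh i; rw [h0] at this; simpa using this)
    have hsurj : Function.Surjective Φ := LinearMap.surjective_of_injective hΦ
    obtain ⟨z, hz⟩ := hsurj (H *ᵥ v i)
    have h5 : star (H *ᵥ v i) ⬝ᵥ (H *ᵥ v i) = 0 := by
      nth_rewrite 1 [← hz]
      rw [hΦsum, star_sum, sum_dotProduct]
      refine Finset.sum_eq_zero fun j _ => ?_
      rw [star_smul, smul_dotProduct, h1, smul_zero]
    rw [dotProduct_star_self_eq_zero] at h5
    have h6 := congrArg (fun w => H⁻¹ *ᵥ w) h5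
    simp only [Matrix.mulVec_mulVec, Matrix.nonsing_inv_mul _ hdet, Matrix.one_mulVec,
      Matrix.mulVec_zero] at h6
    exact hv0 i h6
  set q := (Finset.univ.filter fun i => (μ i).im < 0).card with hq
  have hpos : ∀ c s : ℝ, (c ≠ 0 ∨ s ≠ 0) →
      k - q ≤ (Finset.univ.filter fun i => 0 < h i * (c + s * t i)).card := by
    intro c s hcs
    set T₀ := Finset.univ.filter fun i : {i // (μ i).im = 0} => ¬ 0 < h i * (c + s * t i)
      with hT₀
    -- If fewer than `k - q` entries were positive, the eigenvectors indexed by `T` would span a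
    -- subspace of dimension above `card ι - k` on which `c H + s G` is nonpositive, against `hk`.
    set T : Finset ι := (Finset.univ.filter fun i => 0 < (μ i).im) ∪
      T₀.map (Function.Embedding.subtype _) with hT
    have hTcard : T.card = (Finset.univ.filter fun i => 0 < (μ i).im).card + T₀.card := by
      rw [hT, Finset.card_union_of_disjoint, Finset.card_map]
      rw [Finset.disjoint_left]
      intro i hi hi'
      simp only [Finset.mem_filter, Finset.mem_univ, true_and, Finset.mem_map] at hi hi'
      obtain ⟨j, _, rfl⟩ := hi'
      exact hi.ne' j.2
    have htot : (Finset.univ.filter fun i => 0 < (μ i).im).card + q +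
        Fintype.card {i // (μ i).im = 0} = Fintype.card ι := by
      rw [Fintype.card_subtype, hq, Finset.card_filter, Finset.card_filter, Finset.card_filter,
        ← Finset.sum_add_distrib, ← Finset.sum_add_distrib, ← Finset.card_univ,
        Finset.card_eq_sum_ones]
      refine Finset.sum_congr rfl fun i _ => ?_
      rcases lt_trichotomy (μ i).im 0 with a | a | a
      · simp [a, a.ne, not_lt.mpr a.le]
      · simp [a]
      · simp [a, a.ne', not_lt.mpr a.le]
    have htot₀ : (Finset.univ.filter fun i => 0 < h i * (c + s * t i)).card + T₀.card =
        Fintype.card {i // (μ i).im = 0} := by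
      rw [hT₀, Finset.card_filter_add_card_filter_not, Finset.card_univ]
    let Ψ : (T → ℂ) →ₗ[ℂ] (ι → ℂ) := Function.ExtendByZero.linearMap ℂ Subtype.val
    have hΨ : Function.Injective Ψ := by
      intro a b hab
      funext i
      have := congrFun hab i
      simpa [Ψ, Subtype.val_injective.extend_apply] using this
    have hV : Module.finrank ℂ (LinearMap.range (Φ ∘ₗ Ψ)) = T.card := by
      rw [LinearMap.finrank_range_of_inj (by rw [LinearMap.coe_comp]; exact hΦ.comp hΨ)]
      simp
    by_contra hlt
    obtain ⟨x, ⟨z, rfl⟩, hx⟩ := hk (LinearMap.range (Φ ∘ₗ Ψ)) (by rw [hV]; omega) c s hcs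
    have hzT : ∀ i, Ψ z i ≠ 0 → i ∈ T := by
      intro i hi
      by_contra hiT
      refine hi ?_
      simp only [Ψ, Function.ExtendByZero.linearMap_apply]
      rw [Function.extend_apply' _ _ _ (by rintro ⟨a, rfl⟩; exact hiT a.2)]
      rfl
    have hTim : ∀ i ∈ T, 0 ≤ (μ i).im := by
      intro i hi
      rcases Finset.mem_union.mp hi with a | a
      · exact (Finset.mem_filter.mp a).2.le
      · obtain ⟨j, _, rfl⟩ := Finset.mem_map.mp a
        exact j.2.ge
    rw [LinearMap.comp_apply, hform _ _ (by
      intro i j hi hj hij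
      have h1 := hTim i (hzT i hi)
      have h2 := hTim j (hzT j hj)
      rw [hij] at h2
      simp only [RCLike.star_def, Complex.conj_im] at h2
      linarith), Finset.mul_sum, Complex.re_sum] at hx
    refine absurd hx (not_lt.mpr (Finset.sum_nonpos fun i _ => ?_))
    rw [hμt, hηh, RCLike.star_def, ← Complex.normSq_eq_conj_mul_self]
    have e : (((c : ℂ) - s * Complex.I) * ((1 + Complex.I * (t i : ℂ)) * (h i : ℂ) *
        (Complex.normSq (Ψ z i) : ℂ))).re =
        h i * (c + s * t i) * Complex.normSq (Ψ z i) := by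
      simp
      ring
    rw [e]
    by_cases hz0 : Ψ z i = 0
    · simp [hz0]
    · refine mul_nonpos_of_nonpos_of_nonneg ?_ (Complex.normSq_nonneg _)
      rcases Finset.mem_union.mp (hzT i hz0) with a | a
      · exact absurd i.2 (Finset.mem_filter.mp a).2.ne'
      · obtain ⟨j, hj, hji⟩ := Finset.mem_map.mp a
        have : j = i := Subtype.ext hji
        subst this
        exact not_lt.mp (Finset.mem_filter.mp hj).2
  obtain ⟨L₀, hL₀, hiso⟩ := exists_isotropic_of_forall_le_card_pos h t hh ht (k - q) hpos
  let E₁ : ({i // (μ i).im < 0} → ℂ) →ₗ[ℂ] (ι → ℂ) :=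
    Function.ExtendByZero.linearMap ℂ Subtype.val
  let E₂ : ({i // (μ i).im = 0} → ℂ) →ₗ[ℂ] (ι → ℂ) :=
    Function.ExtendByZero.linearMap ℂ Subtype.val
  have hE₁ : ∀ (a) (i : {i // (μ i).im < 0}), E₁ a i = a i := fun a i => by
    simp [E₁]
  have hE₂ : ∀ (a) (i : {i // (μ i).im = 0}), E₂ a i = a i := fun a i => by
    simp [E₂]
  have hE₁' : ∀ a i, ¬ (μ i).im < 0 → E₁ a i = 0 := by
    intro a i hi
    simp only [E₁, Function.ExtendByZero.linearMap_apply]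
    rw [Function.extend_apply' _ _ _ (by rintro ⟨b, rfl⟩; exact hi b.2)]
    rfl
  have hE₂' : ∀ a i, ¬ (μ i).im = 0 → E₂ a i = 0 := by
    intro a i hi
    simp only [E₂, Function.ExtendByZero.linearMap_apply]
    rw [Function.extend_apply' _ _ _ (by rintro ⟨b, rfl⟩; exact hi b.2)]
    rfl
  -- The `q` eigenvectors in the lower half-plane contribute nothing to the form, so their span can
  -- be added to the isotropic subspace `L₀` found at the real eigenvalues.
  let Ψ : (({i // (μ i).im < 0} → ℂ) × L₀) →ₗ[ℂ] (ι → ℂ) := E₁.coprod (E₂ ∘ₗ L₀.subtype)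
  have hΨapply : ∀ p, Ψ p = E₁ p.1 + E₂ (p.2 : {i // (μ i).im = 0} → ℂ) := fun p => rfl
  have hΨreal : ∀ p (i : {i // (μ i).im = 0}),
      Ψ p i = (p.2 : {i // (μ i).im = 0} → ℂ) i := by
    intro p i
    rw [hΨapply, Pi.add_apply, hE₂, hE₁' _ _ (by rw [i.2]; exact lt_irrefl _), zero_add]
  have hΨneg : ∀ p (i : {i // (μ i).im < 0}), Ψ p i = p.1 i := by
    intro p i
    rw [hΨapply, Pi.add_apply, hE₁, hE₂' _ _ i.2.ne, add_zero]
  have hΨ : Function.Injective Ψ := by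
    intro a b hab
    refine Prod.ext (funext fun i => ?_) (Subtype.ext (funext fun i => ?_))
    · rw [← hΨneg, ← hΨneg, hab]
    · rw [← hΨreal, ← hΨreal, hab]
  refine ⟨LinearMap.range (Φ ∘ₗ Ψ), ?_, ?_⟩
  · rw [LinearMap.finrank_range_of_inj (by rw [LinearMap.coe_comp]; exact hΦ.comp hΨ),
      Module.finrank_prod, Module.finrank_fintype_fun_eq_card, Fintype.card_subtype]
    omega
  · rintro _ ⟨a, rfl⟩ _ ⟨b, rfl⟩
    have him : ∀ p i, Ψ p i ≠ 0 → (μ i).im ≤ 0 := by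
      intro p i hi
      by_contra h1
      refine hi ?_
      rw [hΨapply, Pi.add_apply, hE₁' _ _ (by linarith), hE₂' _ _ (by linarith), add_zero]
    rw [LinearMap.comp_apply, LinearMap.comp_apply, hform _ _ (by
      intro i j hi hj hij
      have h1 := him _ i hi
      have h2 := him _ j hj
      rw [hij] at h2
      simp only [RCLike.star_def, Complex.conj_im] at h2
      linarith)]
    obtain ⟨e1, e2⟩ := hiso _ a.2.2 _ b.2.2
    have e3 : ∀ i : {i // (μ i).im = 0},
        (1 + Complex.I * μ i) * η i i * (star (Ψ a i) * Ψ b i) =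
        (h i : ℂ) * (star ((a.2 : {i // (μ i).im = 0} → ℂ) i) *
          (b.2 : {i // (μ i).im = 0} → ℂ) i) +
        Complex.I * (((h i * t i : ℝ) : ℂ) * (star ((a.2 : {i // (μ i).im = 0} → ℂ) i) *
          (b.2 : {i // (μ i).im = 0} → ℂ) i)) := by
      intro i
      rw [hΨreal, hΨreal, hμt, hηh]
      push_cast
      ring
    simp only [e3]
    rw [Finset.sum_add_distrib, ← Finset.mul_sum, e1, e2]
    simp

/-! ### Isotropic subspaces and the `k`-rank numerical range. -/

theorem mem_rankRange_zero_of_isotropic {n k : ℕ} {A : Matrix (Fin n) (Fin n) ℂ}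
    {X : Matrix (Fin n) (Fin k) ℂ} (hX : X ∈ isometries n k) (L : Submodule ℂ (Fin n → ℂ))
    (hXL : ∀ c, X *ᵥ c ∈ L) (hL : ∀ x ∈ L, ∀ y ∈ L, star x ⬝ᵥ (A *ᵥ y) = 0) :
    (0 : ℂ) ∈ rankRange k A := by
  refine ⟨X, hX, ?_⟩
  ext i j
  have h := hL _ (hXL (Pi.single i 1)) _ (hXL (Pi.single j 1))
  rw [Matrix.mulVec_single_one, Matrix.mulVec_single_one] at h
  rw [zero_smul, Matrix.zero_apply, ← h, Matrix.mul_assoc]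
  rfl

/-- A subspace of dimension at least `m` contains the range of an isometry of `ℂᵐ`. -/
theorem exists_isometry_of_le_finrank {n : ℕ} (m : ℕ) (V : Submodule ℂ (Fin n → ℂ))
    (hm : m ≤ Module.finrank ℂ V) : ∃ X ∈ isometries n m, ∀ c, X *ᵥ c ∈ V := by
  let e := WithLp.linearEquiv 2 ℂ (Fin n → ℂ)
  let W : Submodule ℂ (EuclideanSpace ℂ (Fin n)) := V.comap e.toLinearMap
  have hW : Module.finrank ℂ W = Module.finrank ℂ V :=
    (e.submoduleMap W).finrank_eq.trans (by
      rw [show W.map e.toLinearMap = V from Submodule.map_comap_eq_of_surjective e.surjective V])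
  let b := stdOrthonormalBasis ℂ W
  let f : Fin m → Fin (Module.finrank ℂ W) := Fin.castLE (hm.trans hW.ge)
  let X : Matrix (Fin n) (Fin m) ℂ := fun i j => (b (f j) : EuclideanSpace ℂ (Fin n)) i
  refine ⟨X, ?_, fun c => ?_⟩
  · change Xᴴ * X = 1
    ext i j
    have h := (orthonormal_iff_ite.mp b.orthonormal) (f i) (f j)
    rw [Submodule.coe_inner, EuclideanSpace.inner_eq_star_dotProduct, dotProduct_comm] at h
    rw [Matrix.one_apply]
    have e1 : (f i = f j) ↔ i = j := (Fin.castLE_injective _).eq_iff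
    simp only [e1] at h
    rw [← h]
    rfl
  · have e2 : X *ᵥ c = ∑ j, c j • e (b (f j) : EuclideanSpace ℂ (Fin n)) := by
      ext i
      simp only [Matrix.mulVec, dotProduct, Finset.sum_apply, Pi.smul_apply, smul_eq_mul]
      exact Finset.sum_congr rfl fun j _ => mul_comm _ _
    rw [e2]
    exact V.sum_mem fun j _ => V.smul_mem _ (b (f j)).2

/-- The set is the projection of a closed set along the compact factor of isometries. -/
theorem isClosed_setOf_zero_mem_rankRange (n k : ℕ) :
    IsClosed {A : Matrix (Fin n) (Fin n) ℂ | (0 : ℂ) ∈ rankRange k A} := by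
  have : CompactSpace (isometries n k) := isCompact_iff_compactSpace.mp (isCompact_isometries n k)
  have hcl : IsClosed {p : isometries n k × Matrix (Fin n) (Fin n) ℂ |
      (p.1 : Matrix (Fin n) (Fin k) ℂ)ᴴ * p.2 * (p.1 : Matrix (Fin n) (Fin k) ℂ) =
        (0 : ℂ) • (1 : Matrix (Fin k) (Fin k) ℂ)} :=
    isClosed_eq (by fun_prop) continuous_const
  convert isClosedMap_snd_of_compactSpace _ hcl using 1
  ext A
  constructor
  · rintro ⟨X, hX, h⟩
    exact ⟨(⟨X, hX⟩, A), h, rfl⟩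
  · rintro ⟨⟨X, B⟩, h, rfl⟩
    exact ⟨X, X.2, h⟩

/-! ### Density of simple pencils. -/

/-- `A` is `H + i G` for a Hermitian pencil with simple eigenvalues. -/
def HasSimplePencil {n : ℕ} (A : Matrix (Fin n) (Fin n) ℂ) : Prop :=
  ∃ H G : Matrix (Fin n) (Fin n) ℂ, H.IsHermitian ∧ G.IsHermitian ∧ A = H + Complex.I • G ∧
    IsUnit H.det ∧ ∃ μ : Fin n → ℂ, Function.Injective μ ∧ ∃ v : Fin n → Fin n → ℂ,
      (∀ i, v i ≠ 0) ∧ ∀ i, G *ᵥ v i = μ i • (H *ᵥ v i)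

/-- Applying `H` to `adj(H) G v = λ v` gives `det H • G v = λ • H v`, so the pencil has eigenvalue
`λ / det H`. The adjugate replaces the inverse so that everything is polynomial along a line of
pencils. -/
theorem hasSimplePencil_of_separable {n : ℕ} {H G : Matrix (Fin n) (Fin n) ℂ}
    (hH : H.IsHermitian) (hG : G.IsHermitian) (hdet : H.det ≠ 0)
    (hsep : (H.adjugate * G).charpoly.Separable) : HasSimplePencil (H + Complex.I • G) := by
  have hcard : (H.adjugate * G).charpoly.roots.toFinset.card = n := by
    rw [Multiset.toFinset_card_of_nodup (Polynomial.nodup_roots hsep),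
      IsAlgClosed.card_roots_eq_natDegree, Matrix.charpoly_natDegree_eq_dim, Fintype.card_fin]
  let e := (Finset.equivFinOfCardEq hcard).symm
  have heig : ∀ i, ∃ v : Fin n → ℂ, v ≠ 0 ∧ (H.adjugate * G) *ᵥ v = (e i : ℂ) • v := by
    intro i
    have h1 : (H.adjugate * G).charpoly.IsRoot (e i : ℂ) :=
      Polynomial.isRoot_of_mem_roots (Multiset.mem_toFinset.mp (e i).2)
    obtain ⟨v, hv⟩ := ((Module.End.hasEigenvalue_iff_isRoot_charpoly
      (H.adjugate * G).toLin' (e i : ℂ)).mpr (by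
        rwa [Matrix.charpoly_toLin'])).exists_hasEigenvector
    exact ⟨v, hv.2, by simpa using hv.apply_eq_smul⟩
  choose v hv0 hv using heig
  refine ⟨H, G, hH, hG, rfl, isUnit_iff_ne_zero.mpr hdet, fun i => (e i : ℂ) / H.det, ?_, v, hv0,
    fun i => ?_⟩
  · intro i j hij
    exact e.injective (Subtype.ext ((div_left_inj' hdet).mp hij))
  · change G *ᵥ v i = ((e i : ℂ) / H.det) • (H *ᵥ v i)
    have h1 := congrArg (fun w => H *ᵥ w) (hv i)
    simp only [Matrix.mulVec_mulVec, Matrix.mulVec_smul] at h1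
    rw [← Matrix.mul_assoc, Matrix.mul_adjugate, Matrix.smul_mul, Matrix.one_mul,
      Matrix.smul_mulVec] at h1
    rw [div_eq_inv_mul, mul_smul, ← h1, smul_smul, inv_mul_cancel₀ hdet, one_smul]

open Polynomial in
/-- On the line from a Hermitian pencil to a simple one, all but finitely many pencils are
simple. -/
theorem frequently_separable {n : ℕ} (H G : Matrix (Fin n) (Fin n) ℂ) (d : Fin n → ℂ)
    (hd : Function.Injective d) :
    ∃ᶠ t : ℝ in nhds 0,
      ((1 - (t : ℂ)) • H + (t : ℂ) • 1).det ≠ 0 ∧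
      (((1 - (t : ℂ)) • H + (t : ℂ) • 1).adjugate *
        ((1 - (t : ℂ)) • G + (t : ℂ) • Matrix.diagonal d)).charpoly.Separable := by
  let Hp : Matrix (Fin n) (Fin n) ℂ[X] := (1 - X : ℂ[X]) • H.map C + (X : ℂ[X]) • 1
  let Gp : Matrix (Fin n) (Fin n) ℂ[X] :=
    (1 - X : ℂ[X]) • G.map C + (X : ℂ[X]) • (Matrix.diagonal d).map C
  -- A polynomial in the line parameter that vanishes exactly at the bad pencils. The formal degrees
  -- `n` and `n - 1` make the resultant commute with evaluation.
  let q : ℂ[X] := Hp.det *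
    resultant (Hp.adjugate * Gp).charpoly (derivative (Hp.adjugate * Gp).charpoly) n (n - 1)
  have hHp : ∀ t : ℂ, (evalRingHom t).mapMatrix Hp = (1 - t) • H + t • 1 := by
    intro t
    ext i j
    by_cases hij : i = j <;> simp [Hp, hij]
  have hGp : ∀ t : ℂ, (evalRingHom t).mapMatrix Gp = (1 - t) • G + t • Matrix.diagonal d := by
    intro t
    ext i j
    by_cases hij : i = j
    · subst hij; simp [Gp, mul_comm t]
    · simp [Gp, hij]
  have hq : ∀ t : ℂ, q.eval t ≠ 0 ↔ ((1 - t) • H + t • 1).det ≠ 0 ∧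
      (((1 - t) • H + t • 1).adjugate *
        ((1 - t) • G + t • Matrix.diagonal d)).charpoly.Separable := by
    intro t
    have h1 : q.eval t = evalRingHom t q := rfl
    have h2 : (Hp.adjugate * Gp).charpoly.map (evalRingHom t) =
        (((1 - t) • H + t • 1).adjugate *
          ((1 - t) • G + t • Matrix.diagonal d)).charpoly := by
      rw [← Matrix.charpoly_map, ← RingHom.mapMatrix_apply, map_mul, RingHom.map_adjugate, hHp,
        hGp]
    rw [h1, map_mul, RingHom.map_det, hHp, ← resultant_map_map, ← derivative_map, h2, mul_ne_zero_iff]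
    refine and_congr_right fun _ => ?_
    set p := (((1 - t) • H + t • 1).adjugate *
          ((1 - t) • G + t • Matrix.diagonal d)).charpoly with hp
    have hpd : p.natDegree = n := by
      rw [hp, Matrix.charpoly_natDegree_eq_dim, Fintype.card_fin]
    have hpd' : (derivative p).natDegree = n - 1 := by rw [natDegree_derivative, hpd]
    have hmon : p.Monic := Matrix.charpoly_monic _
    have h3 : resultant p (derivative p) n (n - 1) = resultant p (derivative p) := by
      rw [hpd, hpd']
    rw [h3, ← isUnit_iff_ne_zero, isUnit_resultant_iff_isCoprime hmon]
    rfl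
  have hq0 : q ≠ 0 := by
    intro h0
    -- At parameter `1` the pencil is the identity with `diagonal d`, whose eigenvalues are
    -- distinct.
    refine (hq 1).mpr ⟨by simp, ?_⟩ (by rw [h0, eval_zero])
    simp only [sub_self, zero_smul, one_smul, zero_add, Matrix.adjugate_one, Matrix.one_mul,
      Matrix.charpoly_diagonal]
    exact separable_prod_X_sub_C_iff.mpr hd
  have hfin : {t : ℝ | q.eval (t : ℂ) = 0}.Finite := by
    refine Set.Finite.preimage (f := fun t : ℝ => (t : ℂ)) Complex.ofReal_injective.injOn
      (s := {z : ℂ | q.eval z = 0}) ?_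
    exact (q.roots.toFinset.finite_toSet).subset fun z hz => by
      simpa [hq0] using hz
  have h4 : ∃ᶠ t : ℝ in nhds 0, t ∉ {t : ℝ | q.eval (t : ℂ) = 0} :=
    mem_closure_iff_frequently.mp ((hfin.countable.dense_compl ℝ) 0)
  exact h4.mono fun t ht => (hq t).mp ht

theorem dense_hasSimplePencil (n : ℕ) (A : Matrix (Fin n) (Fin n) ℂ) :
    ∃ᶠ B in nhds A, HasSimplePencil B := by
  let H : Matrix (Fin n) (Fin n) ℂ := (1 / 2 : ℂ) • (A + Aᴴ)
  let G : Matrix (Fin n) (Fin n) ℂ := (-Complex.I / 2) • (A - Aᴴ)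
  have hH : H.IsHermitian := by
    ext i j; simp [H]; ring
  have hG : G.IsHermitian := by
    ext i j; simp [G]; ring
  have hA : A = H + Complex.I • G := by
    ext i j
    simp only [H, G, Matrix.add_apply, Matrix.smul_apply, Matrix.sub_apply, smul_eq_mul]
    linear_combination (1 / 2 : ℂ) * (A i j - Aᴴ i j) * Complex.I_sq
  let d : Fin n → ℂ := fun i => ((i : ℕ) : ℂ)
  let f : ℝ → Matrix (Fin n) (Fin n) ℂ := fun t =>
    ((1 - (t : ℂ)) • H + (t : ℂ) • 1) + Complex.I • ((1 - (t : ℂ)) • G + (t : ℂ) • Matrix.diagonal d)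
  have hf : Filter.Tendsto f (nhds 0) (nhds A) := by
    have hc : Continuous f := by fun_prop
    have := hc.tendsto 0
    have e : f 0 = A := by simp only [f]; simp [← hA]
    rwa [e] at this
  have hd : Function.Injective d := fun i j hij => Fin.ext (Nat.cast_injective hij)
  refine hf.frequently ((frequently_separable H G d hd).mono fun t ht => ?_)
  have h1 : IsSelfAdjoint (1 - (t : ℂ)) := by
    rw [isSelfAdjoint_iff]; simp
  have h2 : IsSelfAdjoint (t : ℂ) := by
    rw [isSelfAdjoint_iff]; simp
  refine hasSimplePencil_of_separable ((hH.smul h1).add (Matrix.isHermitian_one.smul h2))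
    ((hG.smul h1).add (IsHermitian.smul ?_ h2)) ht.1 ht.2
  refine Matrix.isHermitian_diagonal_of_self_adjoint _ ?_
  rw [isSelfAdjoint_iff]
  ext i
  simp [d]

/-! ### The half-plane criterion with a margin. -/

theorem norm_star_dotProduct_mulVec_le {n : ℕ} (E : Matrix (Fin n) (Fin n) ℂ) {x : Fin n → ℂ}
    (hx : star x ⬝ᵥ x = 1) : ‖star x ⬝ᵥ (E *ᵥ x)‖ ≤ ∑ i, ∑ j, ‖E i j‖ := by
  change ‖∑ i, star (x i) * (E *ᵥ x) i‖ ≤ _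
  refine (norm_sum_le _ _).trans (Finset.sum_le_sum fun i _ => ?_)
  have h1 := norm_le_one_of_star_dotProduct hx
  calc ‖star (x i) * (E *ᵥ x) i‖ = ‖x i‖ * ‖(E *ᵥ x) i‖ := by rw [norm_mul, norm_star]
    _ ≤ 1 * ‖(E *ᵥ x) i‖ :=
        mul_le_mul_of_nonneg_right (h1 i) (norm_nonneg _)
    _ ≤ ∑ j, ‖E i j‖ := by
        rw [one_mul]
        change ‖∑ j, E i j * x j‖ ≤ _
        refine (norm_sum_le _ _).trans (Finset.sum_le_sum fun j _ => ?_)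
        rw [norm_mul]
        exact mul_le_of_le_one_right (norm_nonneg _) (h1 j)

/-- If on every subspace of dimension greater than `n - k` the values of `A` at unit vectors enter
every half-plane `δ ≤ Re (u z)`, `|u| = 1`, then `0 ∈ Λ_k(A)`. -/
theorem zero_mem_rankRange_of_margin {n k : ℕ} (A : Matrix (Fin n) (Fin n) ℂ) {δ : ℝ} (hδ : 0 < δ)
    (hA : ∀ V : Submodule ℂ (Fin n → ℂ), n < Module.finrank ℂ V + k → ∀ u : ℂ, ‖u‖ = 1 →
      ∃ x ∈ V, star x ⬝ᵥ x = 1 ∧ δ ≤ (u * (star x ⬝ᵥ (A *ᵥ x))).re) :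
    (0 : ℂ) ∈ rankRange k A := by
  have hnear : ∀ᶠ B in nhds A, ∑ i, ∑ j, ‖(B - A) i j‖ < δ := by
    have hc : Continuous fun B : Matrix (Fin n) (Fin n) ℂ => ∑ i, ∑ j, ‖(B - A) i j‖ := by
      fun_prop
    have := hc.tendsto A
    simp only [sub_self, Matrix.zero_apply, norm_zero, Finset.sum_const_zero] at this
    exact this.eventually (gt_mem_nhds hδ)
  refine (isClosed_setOf_zero_mem_rankRange n k).closure_subset
    (mem_closure_iff_frequently.mpr ?_)
  refine ((dense_hasSimplePencil n A).and_eventually hnear).mono ?_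
  rintro B ⟨⟨H, G, hH, hG, hB, hdet, μ, hμ, v, hv0, hv⟩, hBA⟩
  obtain ⟨L, hL, hiso⟩ := exists_isotropic_of_simple_pencil hH hG hdet μ hμ v hv0 hv k (by
    intro V hV c s hcs
    rw [Fintype.card_fin] at hV
    rw [← hB]
    set z : ℂ := (c : ℂ) - s * Complex.I with hz
    have hz0 : z ≠ 0 := by
      intro h0
      have h1 := congrArg Complex.re h0
      have h2 := congrArg Complex.im h0
      simp [hz] at h1 h2
      rcases hcs with a | a
      · exact a h1
      · exact a h2
    have hzn : 0 < ‖z‖ := norm_pos_iff.mpr hz0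
    -- Passing from `A` to `B` moves the value at a unit vector by less than `δ`, so the real part
    -- stays positive.
    obtain ⟨x, hxV, hx1, hx⟩ := hA V hV (z / ‖z‖) (by
      rw [norm_div, Complex.norm_real, norm_norm, div_self hzn.ne'])
    refine ⟨x, hxV, ?_⟩
    have h3 := (norm_star_dotProduct_mulVec_le (B - A) hx1).trans_lt hBA
    have h4 : z * (star x ⬝ᵥ (B *ᵥ x)) = (‖z‖ : ℂ) * (z / ‖z‖ * (star x ⬝ᵥ (A *ᵥ x))) +
        z * (star x ⬝ᵥ ((B - A) *ᵥ x)) := by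
      have : (‖z‖ : ℂ) ≠ 0 := by exact_mod_cast hzn.ne'
      rw [Matrix.sub_mulVec, dotProduct_sub]
      field_simp
      ring
    rw [h4, Complex.add_re, Complex.re_ofReal_mul]
    have h5 := (abs_le.mp (Complex.abs_re_le_norm (z * (star x ⬝ᵥ ((B - A) *ᵥ x))))).1
    rw [norm_mul] at h5
    nlinarith [mul_lt_mul_of_pos_left h3 hzn, mul_le_mul_of_nonneg_left hx hzn.le])
  obtain ⟨X, hX, hXL⟩ := exists_isometry_of_le_finrank k L hL
  refine mem_rankRange_zero_of_isotropic hX L hXL ?_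
  rw [hB]
  exact hiso

/-! ### Inclusion in the compressed numerical ranges. -/

theorem star_mulVec_dotProduct_mulVec {n m : ℕ} (X : Matrix (Fin n) (Fin m) ℂ)
    (A : Matrix (Fin n) (Fin n) ℂ) (a b : Fin m → ℂ) :
    star (X *ᵥ a) ⬝ᵥ (A *ᵥ (X *ᵥ b)) = star a ⬝ᵥ ((Xᴴ * A * X) *ᵥ b) := by
  rw [Matrix.star_mulVec, ← Matrix.dotProduct_mulVec, Matrix.mulVec_mulVec, Matrix.mulVec_mulVec]

theorem star_mulVec_dotProduct_of_isometry {n m : ℕ} {X : Matrix (Fin n) (Fin m) ℂ}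
    (hX : X ∈ isometries n m) (a b : Fin m → ℂ) :
    star (X *ᵥ a) ⬝ᵥ (X *ᵥ b) = star a ⬝ᵥ b := by
  rw [Matrix.star_mulVec, ← Matrix.dotProduct_mulVec, Matrix.mulVec_mulVec,
    show Xᴴ * X = 1 from hX, Matrix.one_mulVec]

open ComplexOrder in
theorem mem_numRange_of_ne_zero {m : ℕ} {B : Matrix (Fin m) (Fin m) ℂ} {b : Fin m → ℂ}
    (hb : b ≠ 0) {z : ℂ} (h : star b ⬝ᵥ (B *ᵥ b) = z * (star b ⬝ᵥ b)) : z ∈ numRange B := by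
  have h0 : 0 < star b ⬝ᵥ b :=
    lt_of_le_of_ne (dotProduct_star_self_nonneg b) fun h => hb (dotProduct_star_self_eq_zero.mp h.symm)
  obtain ⟨hre, him⟩ := Complex.pos_iff.mp h0
  set r := (star b ⬝ᵥ b).re with hr
  have hbb : star b ⬝ᵥ b = (r : ℂ) := Complex.ext (by simp [hr]) (by simpa using him.symm)
  have hs : (Real.sqrt r : ℂ) * (Real.sqrt r : ℂ) = r := by
    exact_mod_cast Real.mul_self_sqrt hre.le
  have hs0 : (Real.sqrt r : ℂ) ≠ 0 := by exact_mod_cast (Real.sqrt_pos.mpr hre).ne'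
  have key : ∀ y : Fin m → ℂ, star (((Real.sqrt r : ℂ)⁻¹) • b) ⬝ᵥ (((Real.sqrt r : ℂ)⁻¹) • y) =
      (r : ℂ)⁻¹ * (star b ⬝ᵥ y) := by
    intro y
    rw [star_smul, smul_dotProduct, dotProduct_smul, ← hs]
    simp only [RCLike.star_def, map_inv₀, Complex.conj_ofReal, smul_eq_mul, mul_inv]
    ring
  have hr0 : (r : ℂ) ≠ 0 := by exact_mod_cast hre.ne'
  refine ⟨((Real.sqrt r : ℂ)⁻¹) • b, ?_, ?_⟩
  · rw [key, hbb, inv_mul_cancel₀ hr0]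
  · rw [Matrix.mulVec_smul, key, h, hbb]
    field_simp

theorem rankRange_subset_numRange {n k m : ℕ} (hm : n < k + m) (A : Matrix (Fin n) (Fin n) ℂ)
    {M : Matrix (Fin n) (Fin m) ℂ} (hM : M ∈ isometries n m) :
    rankRange k A ⊆ numRange (Mᴴ * A * M) := by
  rintro z ⟨X, hX, hz⟩
  let f : ((Fin k → ℂ) × (Fin m → ℂ)) →ₗ[ℂ] (Fin n → ℂ) :=
    X.mulVecLin.coprod (-M.mulVecLin)
  -- A nonzero kernel element is a common vector `X a = M b` of the two ranges; the value of `A`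
  -- there is `z` times its squared length.
  have hker : LinearMap.ker f ≠ ⊥ := LinearMap.ker_ne_bot_of_finrank_lt (by simpa using hm)
  obtain ⟨⟨a, b⟩, hab, hne⟩ := Submodule.exists_mem_ne_zero_of_ne_bot hker
  have hXM : X *ᵥ a = M *ᵥ b := by
    have h : X *ᵥ a + -(M *ᵥ b) = 0 := hab
    rwa [← sub_eq_add_neg, sub_eq_zero] at h
  have haa : star a ⬝ᵥ a = star b ⬝ᵥ b := by
    rw [← star_mulVec_dotProduct_of_isometry hX, hXM, star_mulVec_dotProduct_of_isometry hM]
  have hb : b ≠ 0 := by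
    rintro rfl
    have h1 : Xᴴ *ᵥ (X *ᵥ a) = 0 := by rw [hXM]; simp
    rw [Matrix.mulVec_mulVec, show Xᴴ * X = 1 from hX, Matrix.one_mulVec] at h1
    exact hne (by rw [h1]; rfl)
  refine mem_numRange_of_ne_zero hb ?_
  rw [← star_mulVec_dotProduct_mulVec, ← hXM, star_mulVec_dotProduct_mulVec, hz,
    Matrix.smul_mulVec, Matrix.one_mulVec, dotProduct_smul, haa, smul_eq_mul]

/-! ### Boundary radii of compact plane sets. -/

theorem norm_le_outerRadius {F : Set ℂ} (hF : IsCompact F) {z : ℂ} (hz : z ∈ F) :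
    ‖z‖ ≤ outerRadius F := by
  obtain ⟨w, hw, hmax⟩ := hF.exists_isMaxOn ⟨z, hz⟩ continuous_norm.continuousOn
  refine (hmax hz).trans ((isGreatest_outerRadius hF ⟨z, hz⟩).2 ⟨w, ?_, rfl⟩)
  refine ⟨subset_closure hw, fun hint => ?_⟩
  obtain ⟨ε, hε, hball⟩ := Metric.isOpen_iff.mp isOpen_interior w hint
  -- If a point of maximal modulus were interior, moving it outward in its own direction `d` would
  -- increase the modulus; at the origin any direction serves.
  obtain ⟨d, hd, hwd⟩ : ∃ d : ℂ, ‖d‖ = 1 ∧ w = ‖w‖ * d := by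
    by_cases h0 : w = 0
    · exact ⟨1, by simp, by simp [h0]⟩
    · have h1 : ‖w‖ ≠ 0 := norm_ne_zero_iff.mpr h0
      refine ⟨w / ‖w‖, by rw [norm_div, Complex.norm_real, norm_norm, div_self h1], ?_⟩
      have : (‖w‖ : ℂ) ≠ 0 := by exact_mod_cast h1
      field_simp
  have h1 : w + ((ε / 2 : ℝ) : ℂ) * d ∈ F := by
    refine interior_subset (hball ?_)
    rw [Metric.mem_ball, dist_eq_norm, add_sub_cancel_left, norm_mul, hd, Complex.norm_real,
      Real.norm_of_nonneg (by positivity)]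
    linarith
  have h2 : ‖w + ((ε / 2 : ℝ) : ℂ) * d‖ ≤ ‖w‖ := hmax h1
  have h3 : w + ((ε / 2 : ℝ) : ℂ) * d = ((‖w‖ + ε / 2 : ℝ) : ℂ) * d := by
    conv_lhs => rw [hwd]
    push_cast
    ring
  rw [h3, norm_mul, hd, Complex.norm_real, Real.norm_of_nonneg (by positivity)] at h2
  linarith

/-- A disc around the origin that meets a compact set but stays within its inner radius lies in
the set. -/
theorem closedBall_subset_of_lt_innerRadius {F : Set ℂ} (hF : IsCompact F) {ρ : ℝ}
    (hρ : ρ < innerRadius F) {z : ℂ} (hz : z ∈ F) (hzρ : ‖z‖ ≤ ρ) :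
    Metric.closedBall 0 ρ ⊆ F := by
  by_contra hnot
  obtain ⟨w, hw, hwF⟩ := Set.not_subset.mp hnot
  have hnf : ∀ y ∈ Metric.closedBall (0 : ℂ) ρ, y ∈ F → y ∈ interior F := by
    intro y hy hyF
    by_contra hint
    have h1 : innerRadius F ≤ ‖y‖ :=
      (isLeast_innerRadius hF ⟨z, hz⟩).2 ⟨y, ⟨subset_closure hyF, hint⟩, rfl⟩
    have h2 := mem_closedBall_zero_iff.mp hy
    linarith
  have hzb : z ∈ Metric.closedBall (0 : ℂ) ρ := mem_closedBall_zero_iff.mpr hzρ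
  obtain ⟨y, -, hy1, hy2⟩ := (convex_closedBall (0 : ℂ) ρ).isPreconnected (interior F) Fᶜ
    isOpen_interior hF.isClosed.isOpen_compl
    (fun y hy => (em (y ∈ F)).imp (hnf y hy) id) ⟨z, hzb, hnf z hzb hz⟩ ⟨w, hw, hwF⟩
  exact hy2 (interior_subset hy1)

/-! ### Passing to the limit along dense projections. -/

theorem isCompact_unitSphere (n : ℕ) : IsCompact {x : Fin n → ℂ | star x ⬝ᵥ x = 1} := by
  refine IsCompact.of_isClosed_subset (isCompact_univ_pi fun _ => isCompact_closedBall (0 : ℂ) 1)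
    (isClosed_eq (by fun_prop) continuous_const) fun x hx i _ => ?_
  rw [mem_closedBall_zero_iff]
  exact norm_le_one_of_star_dotProduct hx i

theorem isClosed_setOf_fixed_value {n : ℕ} (A : Matrix (Fin n) (Fin n) ℂ) (w : ℂ) :
    IsClosed {Q : Matrix (Fin n) (Fin n) ℂ | ∃ x : Fin n → ℂ, star x ⬝ᵥ x = 1 ∧ Q *ᵥ x = x ∧
      star x ⬝ᵥ (A *ᵥ x) = w} := by
  have : CompactSpace {x : Fin n → ℂ | star x ⬝ᵥ x = 1} :=
    isCompact_iff_compactSpace.mp (isCompact_unitSphere n)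
  have hcl : IsClosed {p : {x : Fin n → ℂ | star x ⬝ᵥ x = 1} × Matrix (Fin n) (Fin n) ℂ |
      p.2 *ᵥ (p.1 : Fin n → ℂ) = p.1 ∧
        star (p.1 : Fin n → ℂ) ⬝ᵥ (A *ᵥ (p.1 : Fin n → ℂ)) = w} :=
    (isClosed_eq (by fun_prop) (by fun_prop)).inter (isClosed_eq (by fun_prop) continuous_const)
  convert isClosedMap_snd_of_compactSpace _ hcl using 1
  ext Q
  constructor
  · rintro ⟨x, hx, h⟩
    exact ⟨(⟨x, hx⟩, Q), h, rfl⟩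
  · rintro ⟨⟨x, B⟩, h, rfl⟩
    exact ⟨x, x.2, h⟩

/-- Along a dense family of projections, a common value of the compressed numerical ranges is
attained on every subspace of the dimension of the family. -/
theorem exists_unit_mem_of_dense_projections {n m : ℕ} (A : Matrix (Fin n) (Fin n) ℂ)
    {ι : Type*} (M : ι → Matrix (Fin n) (Fin m) ℂ) (hM : ∀ p, M p ∈ isometries n m)
    (hd : projections n m ⊆ closure (Set.range fun p => M p * (M p)ᴴ)) {w : ℂ}
    (hw : ∀ p, w ∈ numRange ((M p)ᴴ * A * M p)) (V : Submodule ℂ (Fin n → ℂ))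
    (hV : m ≤ Module.finrank ℂ V) :
    ∃ x ∈ V, star x ⬝ᵥ x = 1 ∧ star x ⬝ᵥ (A *ᵥ x) = w := by
  obtain ⟨X, hX, hXV⟩ := exists_isometry_of_le_finrank m V hV
  have hsub : Set.range (fun p => M p * (M p)ᴴ) ⊆
      {Q : Matrix (Fin n) (Fin n) ℂ | ∃ x : Fin n → ℂ, star x ⬝ᵥ x = 1 ∧ Q *ᵥ x = x ∧
        star x ⬝ᵥ (A *ᵥ x) = w} := by
    rintro _ ⟨p, rfl⟩
    obtain ⟨y, hy, hyw⟩ := hw p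
    refine ⟨M p *ᵥ y, ?_, ?_, ?_⟩
    · rw [star_mulVec_dotProduct_of_isometry (hM p), hy]
    · rw [Matrix.mulVec_mulVec, Matrix.mul_assoc, show (M p)ᴴ * M p = 1 from hM p, Matrix.mul_one]
    · rw [star_mulVec_dotProduct_mulVec, hyw]
  -- Fixing a unit vector with value `w` is a closed condition on the matrix, so it passes to `X
  -- Xᴴ`, whose fixed vectors lie in the range of `X`, hence in `V`.
  obtain ⟨x, hx1, hx, hxw⟩ :=
    closure_minimal hsub (isClosed_setOf_fixed_value A w) (hd ⟨X, hX, rfl⟩)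
  refine ⟨x, ?_, hx1, hxw⟩
  rw [← hx, ← Matrix.mulVec_mulVec]
  exact hXV _

end KRank

end

/-! ### The two radius inequalities. -/

theorem proposition3p3 (n k : ℕ) (hk : 1 ≤ k) (hkn : k ≤ n)
    (A : Matrix (Fin n) (Fin n) ℂ) (hne : (KRank.rankRange k A).Nonempty)
    (M : ℕ → Matrix (Fin n) (Fin (n - k + 1)) ℂ)
    (hM : ∀ p, M p ∈ KRank.isometries n (n - k + 1)) :
    KRank.rankRadius k A ≤ (⨅ p : ℕ, KRank.numRadius ((M p).conjTranspose * A * M p)) ∧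
    ((0 : ℂ) ∉ KRank.rankRange k A →
      (KRank.rankRange k A = ⋂ p : ℕ, KRank.numRange ((M p).conjTranspose * A * M p) ∨
        KRank.projections n (n - k + 1) ⊆
          closure (Set.range fun p : ℕ => M p * (M p).conjTranspose)) →
      (⨅ p : ℕ, KRank.innerNumRadius ((M p).conjTranspose * A * M p)) ≤
        KRank.innerRankRadius k A) := by
  have hsub : ∀ p, KRank.rankRange k A ⊆ KRank.numRange ((M p).conjTranspose * A * M p) :=
    fun p => KRank.rankRange_subset_numRange (by omega) A (hM p)
  have hcpt := KRank.isCompact_rankRange hk A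
  refine ⟨le_ciInf fun p => ?_, fun h0 hor => ?_⟩
  · obtain ⟨z, hz, hzr⟩ := (KRank.isGreatest_outerRadius hcpt hne).1
    rw [KRank.rankRadius, ← hzr]
    exact KRank.norm_le_outerRadius (KRank.isCompact_numRange _)
      (hsub p (hcpt.isClosed.frontier_subset hz))
  · by_contra hlt
    obtain ⟨ρ, hρ1, hρ2⟩ := exists_between (not_le.mp hlt)
    obtain ⟨z, hz, hzr⟩ := (KRank.isLeast_innerRadius hcpt hne).1
    have hzΛ := hcpt.isClosed.frontier_subset hz
    have hzρ : ‖z‖ < ρ := hzr.trans_lt hρ1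
    -- `ciInf_le` needs a lower bound: a real infimum over an unbounded set takes the default value
    -- `0`.
    have hbdd : BddBelow (Set.range fun p : ℕ =>
        KRank.innerNumRadius ((M p).conjTranspose * A * M p)) := by
      refine ⟨0, ?_⟩
      rintro _ ⟨p, rfl⟩
      refine Real.sInf_nonneg ?_
      rintro _ ⟨y, _, rfl⟩
      exact norm_nonneg y
    have hball : ∀ p, Metric.closedBall 0 ρ ⊆ KRank.numRange ((M p).conjTranspose * A * M p) :=
      fun p => KRank.closedBall_subset_of_lt_innerRadius (KRank.isCompact_numRange _)
        (hρ2.trans_le (ciInf_le hbdd p)) (hsub p hzΛ) hzρ.le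
    have hρ : 0 < ρ := (norm_nonneg z).trans_lt hzρ
    refine h0 ?_
    rcases hor with heq | hd
    · rw [heq]
      exact Set.mem_iInter.mpr fun p => hball p (Metric.mem_closedBall_self hρ.le)
    · refine KRank.zero_mem_rankRange_of_margin A hρ fun V hV u hu => ?_
      -- The point of the disc furthest in the direction tested by `u` is `ρ * star u`, for which `u
      -- * w = ρ` is exactly the margin.
      obtain ⟨x, hxV, hx1, hx⟩ := KRank.exists_unit_mem_of_dense_projections A M hM hd
        (w := (ρ : ℂ) * star u) (fun p => hball p (by
          rw [mem_closedBall_zero_iff, norm_mul, norm_star, hu, Complex.norm_real,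
            Real.norm_of_nonneg hρ.le, mul_one])) V (by omega)
      refine ⟨x, hxV, hx1, ?_⟩
      have h1 : u * ((ρ : ℂ) * star u) = (ρ : ℂ) := by
        rw [mul_left_comm, RCLike.star_def, Complex.mul_conj, Complex.normSq_eq_norm_sq, hu]
        simp
      rw [hx, h1, Complex.ofReal_re]
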